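/- Let $p,q\ge 0$ be integers, $n=p+q$, and let $\mathcal{C}\ell(p,q)$ be the complex Clifford algebra with identity $e$ and generators $e^1,\dots,e^n$ satisfying $e^ae^b+e^be^a=2\eta^{ab}e$, where $\eta$ is the diagonal matrix with $p$ entries $+1$ followed by $q$ entries $-1$. It has the basis $e^{a_1\ldots a_k}=e^{a_1}\cdots e^{a_k}$, $1\le a_1<\dots<a_k\le n$, $0\le k\le n$ (for $k=0$ the element $e$). Let $\langle U\rangle_k$ be the rank $k$ part of $U$, i.e. its component in the span of the basis elements $e^{a_1\ldots a_k}$ with exactly $k$ indices. Put $$U^{\sim}=\sum_{k=0}^n(-1)^{\frac{k(k-1)}2}\langle U\rangle_k,\qquad U^{\curlywedge}=\sum_{k=0}^n(-1)^{k}\langle U\rangle_k,\qquad U^{\sim\curlywedge}=(U^{\sim})^{\curlywedge},$$ let $U^{\bigtriangledown}$ (for $n=4,5$) be obtained from $U$ by changing the sign of the parts of ranks $4$ and $5$, and let $U^{\bigtriangleup}$ (for $n=5$) be obtained from $U$ by changing the sign of the part of rank $5$. Let $U\in\mathcal{C}\ell(p,q)$ be invertible. Then $$U^{-1}=\begin{cases}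 \dfrac{e}{U}, & n=0;\\[2ex] \dfrac{U^\curlywedge}{U U^\curlywedge}, & n=1;\\[2ex] \dfrac{U^{\sim\curlywedge}}{U U^{\sim\curlywedge}}, & n=2;\\[2ex] \dfrac{U^\sim U^\curlywedge U^{\sim\curlywedge}}{U U^\sim U^\curlywedge U^{\sim\curlywedge}}=\dfrac{U^{\sim\curlywedge} U^\curlywedge U^\sim}{U U^{\sim\curlywedge} U^\curlywedge U^\sim}, & n=3;\\[2ex] \dfrac{U^\sim (U^\curlywedge U^{\sim\curlywedge})^\bigtriangledown}{U U^\sim (U^\curlywedge U^{\sim\curlywedge})^\bigtriangledown}=\dfrac{U^{\sim\curlywedge} (U^\curlywedge U^{\sim})^\bigtriangledown}{ U U^{\sim\curlywedge} (U^\curlywedge U^{\sim})^\bigtriangledown}, & n=4;\\[2ex] \dfrac{U^\sim (U^\curlywedge U^{\sim\curlywedge})^\bigtriangledown \bigl(U U^\sim (U^\curlywedge U^{\sim\curlywedge})^\bigtriangledown\bigr)^\bigtriangleup}{U U^\sim (U^\curlywedge U^{\sim\curlywedge})^\bigtriangledown \bigl(U U^\sim (U^\curlywedge U^{\sim\curlywedge})^\bigtriangledown\bigr)^\bigtriangleup},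 & n=5. \end{cases}$$ Here every denominator is an element $d\,e$ of rank $0$ with $d\in\mathbb{C}$, $d\neq 0$, and is identified with the complex number $d$; the quotient $N/(d\,e)$ means $d^{-1}N$. -/

import Mathlib

noncomputable section

namespace CliffordInverse

open Module

/-- The diagonal entries `η^{aa}`: the first `p` are `+1`, the remaining `q` are `-1`. -/
def eta (p q : ℕ) (a : Fin (p + q)) : ℂ := if (a : ℕ) < p then 1 else -1

/-- The diagonal quadratic form `v ↦ ∑ a, η^{aa} v_a ^ 2` on `ℂ^(p+q)`. -/
def form (p q : ℕ) : QuadraticForm ℂ (Fin (p + q) → ℂ) :=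
  QuadraticMap.weightedSumSquares ℂ (eta p q)

/-- The complex Clifford algebra `Cl(p,q)`. -/
abbrev Cl (p q : ℕ) : Type := CliffordAlgebra (form p q)

/-- The generators `e^a`. -/
def gen (p q : ℕ) (a : Fin (p + q)) : Cl p q :=
  CliffordAlgebra.ι (form p q) (Pi.single a 1)

/-- `e^{a_1 ... a_k} = e^{a_1} ⋯ e^{a_k}` for `A = {a_1 < ... < a_k}`; `e^∅` is the identity. -/
def blade (p q : ℕ) (A : Finset (Fin (p + q))) : Cl p q :=
  ((A.sort (· ≤ ·)).map (gen p q)).prod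

theorem form_apply (p q : ℕ) (v : Fin (p + q) → ℂ) :
    form p q v = ∑ a, eta p q a * (v a * v a) := by
  simp [form, QuadraticMap.weightedSumSquares_apply]

theorem form_polar_single (p q : ℕ) {a b : Fin (p + q)} (h : a ≠ b) :
    QuadraticMap.polar (form p q) (Pi.single a 1) (Pi.single b 1) = 0 := by
  simp only [QuadraticMap.polar, form_apply, ← Finset.sum_sub_distrib]
  refine Finset.sum_eq_zero fun c _ => ?_
  simp only [Pi.add_apply, Pi.single_apply]
  by_cases h1 : c = a
  · simp [h1, h]
  · simp [h1]

theorem gen_mul_self (p q : ℕ) (a : Fin (p + q)) :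
    gen p q a * gen p q a = algebraMap ℂ (Cl p q) (eta p q a) := by
  rw [gen, CliffordAlgebra.ι_sq_scalar, form_apply]
  congr 1
  simp [Pi.single_apply]

theorem gen_mul_gen (p q : ℕ) {a b : Fin (p + q)} (h : a ≠ b) :
    gen p q a * gen p q b = -(gen p q b * gen p q a) := by
  apply eq_neg_of_add_eq_zero_left
  rw [gen, gen, CliffordAlgebra.ι_mul_ι_add_swap, form_polar_single p q h, map_zero]

theorem associated_single (p q : ℕ) {a b : Fin (p + q)} (h : a ≠ b) :
    QuadraticMap.associated (R := ℂ) (-form p q) (Pi.single a 1) (Pi.single b 1) = 0 := by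
  rw [QuadraticMap.associated_apply]
  have := form_polar_single p q h
  simp only [QuadraticMap.polar] at this
  simp only [neg_apply]
  rw [show -form p q (Pi.single a 1 + Pi.single b 1) - -form p q (Pi.single a 1)
    - -form p q (Pi.single b 1) = -(form p q (Pi.single a 1 + Pi.single b 1)
      - form p q (Pi.single a 1) - form p q (Pi.single b 1)) by ring, this]
  simp

theorem contractLeft_prod {M : Type*} [AddCommGroup M] [Module ℂ M] (Q : QuadraticForm ℂ M)
    (d : Module.Dual ℂ M) (l : List M) (h : ∀ m ∈ l, d m = 0) :
    CliffordAlgebra.contractLeft d (l.map (CliffordAlgebra.ι Q)).prod = 0 := by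
  induction l with
  | nil => simp
  | cons m l ih =>
    rw [List.map_cons, List.prod_cons, CliffordAlgebra.contractLeft_ι_mul,
      ih fun x hx => h x (List.mem_cons_of_mem _ hx), h m List.mem_cons_self]
    simp

theorem equivExterior_prod (p q : ℕ) (l : List (Fin (p + q))) (hl : l.Nodup) :
    CliffordAlgebra.equivExterior (form p q) (l.map (gen p q)).prod =
      (l.map fun a => ExteriorAlgebra.ι ℂ (Pi.single a 1 : Fin (p + q) → ℂ)).prod := by
  change CliffordAlgebra.changeForm CliffordAlgebra.changeForm.associated_neg_proof _ = _
  induction l with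
  | nil => simp
  | cons a l ih =>
    rw [List.nodup_cons] at hl
    rw [List.map_cons, List.prod_cons, gen, CliffordAlgebra.changeForm_ι_mul, ih hl.2,
      List.map_cons, List.prod_cons]
    have := contractLeft_prod (0 : QuadraticForm ℂ (Fin (p + q) → ℂ))
      (QuadraticMap.associated (R := ℂ) (-form p q) (Pi.single a 1))
      (l.map fun b => Pi.single b 1) (by
        intro m hm
        obtain ⟨b, hb, rfl⟩ := List.mem_map.1 hm
        exact associated_single p q fun hab => hl.1 (hab ▸ hb))
    rw [List.map_map] at this
    erw [this]
    rw [sub_zero]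

theorem equivExterior_blade (p q : ℕ) (A : Finset (Fin (p + q))) :
    CliffordAlgebra.equivExterior (form p q) (blade p q A) =
      (Pi.basisFun ℂ (Fin (p + q))).ExteriorAlgebra A := by
  rw [blade, equivExterior_prod p q _ (Finset.sort_nodup _ _),
    ExteriorAlgebra.basis_apply_ofCard _ rfl, ExteriorAlgebra.ιMulti_family,
    ExteriorAlgebra.ιMulti_apply]
  congr 1
  apply List.ext_getElem
  · simp
  · intro i h1 h2
    simp only [List.getElem_map, List.getElem_ofFn, Function.comp, Pi.basisFun_apply]
    rfl

theorem linearIndependent_blade (p q : ℕ) : LinearIndependent ℂ (blade p q) := by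
  have h : (CliffordAlgebra.equivExterior (form p q)).toLinearMap ∘ blade p q =
      (Pi.basisFun ℂ (Fin (p + q))).ExteriorAlgebra :=
    funext (equivExterior_blade p q)
  refine LinearIndependent.of_comp (CliffordAlgebra.equivExterior (form p q)).toLinearMap ?_
  rw [h]
  exact Basis.linearIndependent _

theorem span_blade (p q : ℕ) : ⊤ ≤ Submodule.span ℂ (Set.range (blade p q)) := by
  intro x _
  have h : (CliffordAlgebra.equivExterior (form p q)).toLinearMap ∘ blade p q =
      (Pi.basisFun ℂ (Fin (p + q))).ExteriorAlgebra :=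
    funext (equivExterior_blade p q)
  have hx : CliffordAlgebra.equivExterior (form p q) x ∈
      Submodule.span ℂ (Set.range ((Pi.basisFun ℂ (Fin (p + q))).ExteriorAlgebra)) := by
    rw [Basis.span_eq]; trivial
  rw [← h, Set.range_comp, Submodule.span_image] at hx
  obtain ⟨y, hy, hyx⟩ := hx
  rwa [← (CliffordAlgebra.equivExterior (form p q)).injective hyx]

/-- The basis `(e^A)` of `Cl(p,q)`, indexed by the subsets `A` of `{1, ..., n}`. -/
def bladeBasis (p q : ℕ) : Basis (Finset (Fin (p + q))) ℂ (Cl p q) :=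
  Basis.mk (linearIndependent_blade p q) (span_blade p q)

/-- The rank `k` part of `U`: the part of its expansion in the basis `(e^A)` with `|A| = k`. -/
def gradePart {p q : ℕ} (k : ℕ) (U : Cl p q) : Cl p q :=
  ∑ A ∈ Finset.univ.powersetCard k, (bladeBasis p q).repr U A • blade p q A

/-- Reverse `U^~`. -/
def rev {p q : ℕ} (U : Cl p q) : Cl p q :=
  ∑ k ∈ Finset.range (p + q + 1), (-1 : ℂ) ^ (k * (k - 1) / 2) • gradePart k U

/-- Grade involution `U^⋏`. -/
def invol {p q : ℕ} (U : Cl p q) : Cl p q :=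
  ∑ k ∈ Finset.range (p + q + 1), (-1 : ℂ) ^ k • gradePart k U

/-- Clifford conjugation `U^{~⋏}`, the composition of reverse and grade involution. -/
def cliffConj {p q : ℕ} (U : Cl p q) : Cl p q := invol (rev U)

/-- The operation `▽`: it changes the sign of the parts of ranks `4` and `5`
(used for `n = 4`, where there is no rank `5`, and for `n = 5`). -/
def nabla {p q : ℕ} (U : Cl p q) : Cl p q :=
  ∑ k ∈ Finset.range (p + q + 1), (if k = 4 ∨ k = 5 then -1 else 1 : ℂ) • gradePart k U

/-- The operation `△`: it changes the sign of the part of rank `5` (used for `n = 5`). -/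
def delta {p q : ℕ} (U : Cl p q) : Cl p q :=
  ∑ k ∈ Finset.range (p + q + 1), (if k = 5 then -1 else 1 : ℂ) • gradePart k U

theorem gradePart_blade (p q : ℕ) (k : ℕ) (A : Finset (Fin (p + q))) :
    gradePart k (blade p q A) = if A.card = k then blade p q A else 0 := by
  have hA : blade p q A = bladeBasis p q A := (Basis.mk_apply _ _ _).symm
  have h : ∀ B, (bladeBasis p q).repr (blade p q A) B = if A = B then 1 else 0 := by
    intro B
    rw [hA, Basis.repr_self, Finsupp.single_apply]
  simp only [gradePart, h, ite_smul, one_smul, zero_smul, Finset.sum_ite_eq,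
    Finset.mem_powersetCard, Finset.subset_univ, true_and]

theorem gradePart_add {p q : ℕ} (k : ℕ) (U V : Cl p q) :
    gradePart k (U + V) = gradePart k U + gradePart k V := by
  simp [gradePart, add_smul, Finset.sum_add_distrib]

theorem gradePart_smul {p q : ℕ} (k : ℕ) (c : ℂ) (U : Cl p q) :
    gradePart k (c • U) = c • gradePart k U := by
  simp [gradePart, Finset.smul_sum, mul_smul]

theorem sum_gradePart_blade (p q : ℕ) (f : ℕ → ℂ) (A : Finset (Fin (p + q))) :
    ∑ k ∈ Finset.range (p + q + 1), f k • gradePart k (blade p q A) =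
      f A.card • blade p q A := by
  have hc : A.card < p + q + 1 :=
    Nat.lt_succ_of_le (by simpa using Finset.card_le_univ A)
  simp only [gradePart_blade, smul_ite, smul_zero]
  rw [Finset.sum_ite_eq, if_pos (Finset.mem_range.2 hc)]

/-- A linear map that acts on every `e^A` as the scalar `f |A|` is given by the corresponding
combination of the rank projections. -/
theorem sum_gradePart_eq {p q : ℕ} (f : ℕ → ℂ) (g : Cl p q →ₗ[ℂ] Cl p q)
    (h : ∀ A, g (blade p q A) = f A.card • blade p q A) (U : Cl p q) :
    ∑ k ∈ Finset.range (p + q + 1), f k • gradePart k U = g U := by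
  have hU : U ∈ Submodule.span ℂ (Set.range (blade p q)) := span_blade p q trivial
  induction hU using Submodule.span_induction with
  | mem x hx =>
    obtain ⟨A, rfl⟩ := hx
    rw [sum_gradePart_blade, h]
  | zero => simp [gradePart]
  | add x y _ _ hx hy =>
    simp only [gradePart_add, smul_add, Finset.sum_add_distrib, map_add, hx, hy]
  | smul c x _ hx =>
    rw [map_smul, ← hx, Finset.smul_sum]
    exact Finset.sum_congr rfl fun k _ => by rw [gradePart_smul, smul_comm]

/-- The grade involution is Mathlib's. -/
theorem invol_eq_involute {p q : ℕ} (U : Cl p q) : invol U = CliffordAlgebra.involute U := by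
  refine sum_gradePart_eq (fun k => (-1 : ℂ) ^ k) CliffordAlgebra.involute.toLinearMap ?_ U
  intro A
  have : ∀ l : List (Fin (p + q)), CliffordAlgebra.involute (l.map (gen p q)).prod =
      (-1 : ℂ) ^ l.length • (l.map (gen p q)).prod := by
    intro l
    induction l with
    | nil => simp
    | cons a l ih =>
      rw [List.map_cons, List.prod_cons, map_mul, ih, List.length_cons, pow_succ, gen,
        CliffordAlgebra.involute_ι]
      simp
  simpa [blade] using this (A.sort (· ≤ ·))

/-- Reverse is Mathlib's. -/
theorem rev_eq_reverse {p q : ℕ} (U : Cl p q) : rev U = CliffordAlgebra.reverse U := by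
  refine sum_gradePart_eq (fun k => (-1 : ℂ) ^ (k * (k - 1) / 2)) CliffordAlgebra.reverse ?_ U
  intro A
  have hcomm : ∀ (a : Fin (p + q)) (l : List (Fin (p + q))), a ∉ l →
      (l.map (gen p q)).prod * gen p q a =
        (-1 : ℂ) ^ l.length • (gen p q a * (l.map (gen p q)).prod) := by
    intro a l
    induction l with
    | nil => simp
    | cons b l ih =>
      intro h
      rw [List.mem_cons, not_or] at h
      rw [List.map_cons, List.prod_cons, mul_assoc, ih h.2, List.length_cons, pow_succ,
        mul_smul_comm, ← mul_assoc, ← mul_assoc, gen_mul_gen p q (Ne.symm h.1)]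
      simp
  have : ∀ l : List (Fin (p + q)), l.Nodup → CliffordAlgebra.reverse (l.map (gen p q)).prod =
      (-1 : ℂ) ^ (l.length * (l.length - 1) / 2) • (l.map (gen p q)).prod := by
    intro l
    induction l with
    | nil => simp
    | cons a l ih =>
      intro h
      rw [List.nodup_cons] at h
      have he : (l.length + 1) * (l.length + 1 - 1) / 2 =
          l.length * (l.length - 1) / 2 + l.length := by
        rw [← Nat.choose_two_right, ← Nat.choose_two_right, Nat.choose_succ_succ', Nat.choose_one_right,
          add_comm]
      rw [List.map_cons, List.prod_cons, CliffordAlgebra.reverse.map_mul, ih h.2,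
        List.length_cons, he, pow_add, gen, CliffordAlgebra.reverse_ι, ← gen, smul_mul_assoc,
        hcomm a l h.1, smul_smul]
  simpa [blade] using this (A.sort (· ≤ ·)) (Finset.sort_nodup _ _)

/-- `X = N / D`: the denominator `D` is a nonzero element `d e` of rank `0`, which is identified
with the complex number `d`, and `X` is `N` divided by `d`. -/
def IsQuotient {p q : ℕ} (X N D : Cl p q) : Prop :=
  ∃ d : ℂ, d ≠ 0 ∧ D = algebraMap ℂ (Cl p q) d ∧ X = d⁻¹ • N

end CliffordInverse

end

noncomputable section

namespace CliffordInverse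

open CliffordAlgebra

variable {p q : ℕ}

/-! Write `I` for the pseudoscalar. It suffices to show that `U * N` is a scalar and `N ≠ 0`: if the
scalar were `0`, cancelling `U` would give `N = 0` (`isQuotient_of_mul`).

Scalarity: `V = U * rev U` is fixed by reversal, so for `n ≤ 5` only ranks 0, 1, 4, 5 survive; `U *
cliffConj U` is fixed by conjugation, which for `n ≤ 4` leaves ranks 0, 3, 4. The remaining factors
of `N` form `invol V`, corrected by `nabla` when `n ≥ 4`, and the signs are such that `V = a + X`
becomes `a - X`. For `n ≤ 4` the number `a` is a scalar and `X` is built from a vector and `I` so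
that its square is a scalar; hence `a² - X²` is one too. For `n = 5`, `I` is central, `a` lies in `ℂ
+ ℂI` and `X = v + uI` has its square there. So `V * nabla (invol V)` lies in `ℂ + ℂI`, and `delta`,
which negates `I`, finishes.

Nonvanishing: a rank-wise sign change is an involution, hence injective, and the other factors are
units. Only `n = 5` needs more (`nabla_invol_mul_delta_ne_zero_of_dim_five`). -/

/-! ### Linear maps acting by a scalar on each rank. -/

/-- The linear map multiplying the part of rank `k` by `f k`. -/
def gradeScale (p q : ℕ) (f : ℕ → ℂ) : Cl p q →ₗ[ℂ] Cl p q where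
  toFun U := ∑ k ∈ Finset.range (p + q + 1), f k • gradePart k U
  map_add' U V := by simp only [gradePart_add, smul_add, Finset.sum_add_distrib]
  map_smul' c U := by
    simp only [gradePart_smul, RingHom.id_apply, Finset.smul_sum, smul_comm c]

theorem gradeScale_blade (f : ℕ → ℂ) (A : Finset (Fin (p + q))) :
    gradeScale p q f (blade p q A) = f A.card • blade p q A :=
  sum_gradePart_blade p q f A

theorem linearMap_ext_blade {M : Type*} [AddCommMonoid M] [Module ℂ M] {g h : Cl p q →ₗ[ℂ] M}
    (H : ∀ A, g (blade p q A) = h (blade p q A)) : g = h :=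
  (bladeBasis p q).ext fun A => by simpa [bladeBasis] using H A

theorem gradeScale_gradeScale (f g : ℕ → ℂ) (U : Cl p q) :
    gradeScale p q f (gradeScale p q g U) = gradeScale p q (fun k => f k * g k) U := by
  refine LinearMap.congr_fun (f := gradeScale p q f ∘ₗ gradeScale p q g) ?_ U
  refine linearMap_ext_blade fun A => ?_
  simp only [LinearMap.comp_apply, gradeScale_blade, map_smul, smul_smul, mul_comm]

theorem gradeScale_one (U : Cl p q) : gradeScale p q (fun _ => 1) U = U := by
  refine LinearMap.congr_fun (g := LinearMap.id) ?_ U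
  refine linearMap_ext_blade fun A => ?_
  simp [gradeScale_blade]

theorem sum_gradePart (U : Cl p q) :
    ∑ k ∈ Finset.range (p + q + 1), gradePart k U = U := by
  conv_rhs => rw [← gradeScale_one U]
  simp [gradeScale]

theorem gradePart_gradeScale (f : ℕ → ℂ) {k : ℕ} (U : Cl p q) :
    gradePart k (gradeScale p q f U) = f k • gradePart k U := by
  let g : Cl p q →ₗ[ℂ] Cl p q := ⟨⟨gradePart k, gradePart_add k⟩, gradePart_smul k⟩
  refine LinearMap.congr_fun (f := g ∘ₗ gradeScale p q f) (g := f k • g) ?_ U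
  refine linearMap_ext_blade fun A => ?_
  change gradePart k (gradeScale p q f (blade p q A)) = f k • gradePart k (blade p q A)
  rw [gradeScale_blade, gradePart_smul, gradePart_blade]
  split_ifs with h
  · rw [h]
  · simp

/-- The parts of rank `k` of an eigenvector vanish when `f k` is not the eigenvalue. -/
theorem gradePart_eq_zero {f : ℕ → ℂ} {U : Cl p q} (h : gradeScale p q f U = U) {k : ℕ}
    (hk : f k ≠ 1) : gradePart k U = 0 := by
  have := gradePart_gradeScale f (k := k) U
  rw [h] at this
  have h2 : (f k - 1) • gradePart k U = 0 := by rw [sub_smul, one_smul, ← this, sub_self]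
  exact (smul_eq_zero.1 h2).resolve_left (sub_ne_zero.2 hk)

/-- Such a scaling is its own inverse. This serves `nabla` and `delta`, for which multiplicativity
is not available. -/
theorem gradeScale_ne_zero {f : ℕ → ℂ} (hf : ∀ k, f k * f k = 1) {U : Cl p q} (hU : U ≠ 0) :
    gradeScale p q f U ≠ 0 := by
  intro h
  apply hU
  have := gradeScale_gradeScale f f U
  rw [h, map_zero] at this
  simpa [hf, gradeScale_one] using this.symm

/-! ### Products of distinct generators. -/

/-- The product of the generators along a list. -/
abbrev genProd (p q : ℕ) (l : List (Fin (p + q))) : Cl p q := (l.map (gen p q)).prod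

/-- Each adjacent swap costs a factor `-1`; later arguments need only that the total factor is
nonzero. -/
theorem genProd_perm {l m : List (Fin (p + q))} (h : l.Perm m) :
    l.Nodup → ∃ s : ℂ, s ≠ 0 ∧ genProd p q l = s • genProd p q m := by
  induction h with
  | nil => exact fun _ => ⟨1, one_ne_zero, by simp⟩
  | cons a _ ih =>
    intro hn
    obtain ⟨s, hs, e⟩ := ih (List.nodup_cons.1 hn).2
    refine ⟨s, hs, ?_⟩
    simp only [genProd, List.map_cons, List.prod_cons] at e ⊢
    rw [e, mul_smul_comm]
  | swap a b l =>
    intro hn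
    refine ⟨-1, by simp, ?_⟩
    have hab : b ≠ a := by
      rintro rfl
      simp at hn
    simp only [genProd, List.map_cons, List.prod_cons]
    rw [← mul_assoc, gen_mul_gen p q hab, neg_one_smul, neg_mul, mul_assoc]
  | trans h1 _ ih1 ih2 =>
    intro hn
    obtain ⟨s, hs, e⟩ := ih1 hn
    obtain ⟨t, ht, e'⟩ := ih2 (h1.nodup_iff.1 hn)
    exact ⟨s * t, mul_ne_zero hs ht, by rw [e, e', smul_smul]⟩

theorem genProd_mul_gen {a : Fin (p + q)} {l : List (Fin (p + q))} (h : a ∉ l) :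
    genProd p q l * gen p q a = (-1 : ℂ) ^ l.length • (gen p q a * genProd p q l) := by
  induction l with
  | nil => simp [genProd]
  | cons b l ih =>
    rw [List.mem_cons, not_or] at h
    have := ih h.2
    simp only [genProd, List.map_cons, List.prod_cons, List.length_cons] at this ⊢
    rw [mul_assoc, this, pow_succ, mul_smul_comm, ← mul_assoc, ← mul_assoc,
      gen_mul_gen p q (Ne.symm h.1)]
    simp

/-- After `a` is moved to the front, it anticommutes with the other `l.length - 1` generators and
commutes with itself; the reordering factor occurs on both sides. -/
theorem genProd_mul_gen_of_mem {a : Fin (p + q)} {l : List (Fin (p + q))} (hn : l.Nodup)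
    (h : a ∈ l) :
    genProd p q l * gen p q a = (-1 : ℂ) ^ (l.length - 1) • (gen p q a * genProd p q l) := by
  obtain ⟨s, -, e⟩ := genProd_perm (List.perm_cons_erase h) hn
  have hna : a ∉ l.erase a := hn.not_mem_erase
  have hc := genProd_mul_gen (p := p) (q := q) hna
  rw [List.length_erase_of_mem h] at hc
  simp only [genProd, List.map_cons, List.prod_cons] at e hc ⊢
  rw [e, smul_mul_assoc, mul_assoc, hc, mul_smul_comm, mul_smul_comm, smul_comm]

theorem genProd_mul_self {l : List (Fin (p + q))} (hn : l.Nodup) :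
    ∃ c : ℂ, genProd p q l * genProd p q l = algebraMap ℂ (Cl p q) c := by
  induction l with
  | nil => exact ⟨1, by simp [genProd]⟩
  | cons a l ih =>
    rw [List.nodup_cons] at hn
    obtain ⟨c, hc⟩ := ih hn.2
    have h := genProd_mul_gen (p := p) (q := q) hn.1
    refine ⟨(-1) ^ l.length * (eta p q a * c), ?_⟩
    simp only [genProd, List.map_cons, List.prod_cons] at hc h ⊢
    rw [mul_assoc, ← mul_assoc _ (gen p q a), h, smul_mul_assoc, mul_smul_comm, mul_assoc, hc,
      ← mul_assoc, gen_mul_self, map_mul, map_mul, Algebra.smul_def]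

/-! ### The pseudoscalar and its commutation with vectors. -/

/-- The pseudoscalar `e^{1...n}`. -/
abbrev pseudoscalar (p q : ℕ) : Cl p q := blade p q Finset.univ

theorem pseudoscalar_mul_self (p q : ℕ) :
    ∃ c : ℂ, pseudoscalar p q * pseudoscalar p q = algebraMap ℂ (Cl p q) c :=
  genProd_mul_self (Finset.sort_nodup _ _)

theorem ι_eq_sum (v : Fin (p + q) → ℂ) : ι (form p q) v = ∑ a, v a • gen p q a := by
  conv_lhs => rw [pi_eq_sum_univ' v]
  rw [map_sum]
  refine Finset.sum_congr rfl fun a _ => ?_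
  rw [map_smul, gen]

/-- Each generator occurs once in the pseudoscalar. The truncated exponent at `n = 0` is harmless,
since there all vectors vanish. -/
theorem pseudoscalar_mul_ι (v : Fin (p + q) → ℂ) :
    pseudoscalar p q * ι (form p q) v =
      (-1 : ℂ) ^ (p + q - 1) • (ι (form p q) v * pseudoscalar p q) := by
  rw [ι_eq_sum, Finset.mul_sum, Finset.sum_mul, Finset.smul_sum]
  refine Finset.sum_congr rfl fun a _ => ?_
  have := genProd_mul_gen_of_mem (p := p) (q := q) (a := a)
    (Finset.sort_nodup Finset.univ (· ≤ ·)) (by simp)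
  rw [Finset.length_sort, Finset.card_univ, Fintype.card_fin] at this
  rw [mul_smul_comm, pseudoscalar, blade, this, smul_mul_assoc, smul_comm]

theorem pseudoscalar_mul_ι_of_odd (h : Odd (p + q)) (v : Fin (p + q) → ℂ) :
    pseudoscalar p q * ι (form p q) v = ι (form p q) v * pseudoscalar p q := by
  rw [pseudoscalar_mul_ι, (Nat.Odd.sub_odd h odd_one).neg_one_pow, one_smul]

theorem pseudoscalar_mul_ι_of_even (h : Even (p + q)) (h0 : p + q ≠ 0) (v : Fin (p + q) → ℂ) :
    pseudoscalar p q * ι (form p q) v = -(ι (form p q) v * pseudoscalar p q) := by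
  rw [pseudoscalar_mul_ι, (Nat.Even.sub_odd (by omega) h odd_one).neg_one_pow, neg_one_smul]

theorem eta_mul_self (p q : ℕ) (a : Fin (p + q)) : eta p q a * eta p q a = 1 := by
  unfold eta
  split_ifs <;> norm_num

theorem blade_compl_singleton (a : Fin (p + q)) :
    ∃ s : ℂ, s ≠ 0 ∧ blade p q {a}ᶜ = s • (gen p q a * pseudoscalar p q) := by
  have hp : (a :: ({a}ᶜ : Finset (Fin (p + q))).sort (· ≤ ·)).Perm
      ((Finset.univ : Finset (Fin (p + q))).sort (· ≤ ·)) := by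
    rw [List.perm_ext_iff_of_nodup]
    · intro b
      simp [em]
    · simp
    · simp
  obtain ⟨s, hs, e⟩ := genProd_perm hp (by simp)
  have he : eta p q a ≠ 0 := left_ne_zero_of_mul_eq_one (eta_mul_self p q a)
  -- Left multiplication of `e` by `gen p q a` turns its left side into `eta p q a` times the
  -- complementary blade, and `eta p q a` is its own inverse.
  refine ⟨eta p q a * s, mul_ne_zero he hs, ?_⟩
  simp only [genProd, List.map_cons, List.prod_cons] at e
  rw [mul_smul, ← mul_smul_comm, pseudoscalar, blade, blade, ← e, ← mul_assoc, gen_mul_self,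
    ← Algebra.smul_def, smul_smul, eta_mul_self, one_smul]

/-! ### Normal forms of the parts of ranks 0, 1, n - 1 and n. -/

theorem gradePart_zero_eq (U : Cl p q) :
    ∃ c : ℂ, gradePart 0 U = algebraMap ℂ (Cl p q) c :=
  ⟨(bladeBasis p q).repr U ∅, by simp [gradePart, blade, Algebra.algebraMap_eq_smul_one]⟩

theorem gradePart_mem {k : ℕ} {S : Submodule ℂ (Cl p q)}
    (h : ∀ A : Finset (Fin (p + q)), A.card = k → blade p q A ∈ S) (U : Cl p q) :
    gradePart k U ∈ S :=
  S.sum_mem fun A hA => S.smul_mem _ (h A (Finset.mem_powersetCard.1 hA).2)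

theorem blade_singleton (a : Fin (p + q)) : blade p q {a} = gen p q a := by
  simp [blade]

theorem gradePart_one_eq (U : Cl p q) : ∃ v, gradePart 1 U = ι (form p q) v := by
  have := gradePart_mem (k := 1) (S := LinearMap.range (ι (form p q))) (fun A hA => by
    obtain ⟨a, rfl⟩ := Finset.card_eq_one.1 hA
    rw [blade_singleton]
    exact ⟨_, rfl⟩) U
  obtain ⟨v, hv⟩ := this
  exact ⟨v, hv.symm⟩

theorem gradePart_top_eq {k : ℕ} (hk : p + q = k) (U : Cl p q) :
    ∃ c : ℂ, gradePart k U = c • pseudoscalar p q := by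
  have := gradePart_mem (k := k) (S := Submodule.span ℂ {pseudoscalar p q}) (fun A hA => by
    rw [Finset.eq_univ_of_card A (by simpa [hk] using hA)]
    exact Submodule.mem_span_singleton_self _) U
  obtain ⟨c, hc⟩ := Submodule.mem_span_singleton.1 this
  exact ⟨c, hc.symm⟩

/-- Hodge duality: the blade omitting `a` is a multiple of `gen p q a * pseudoscalar p q`. Products
in rank `n - 1` thus reduce to commuting vectors past the pseudoscalar. -/
theorem gradePart_pred_eq {k : ℕ} (hk : p + q = k + 1) (U : Cl p q) :
    ∃ v, gradePart k U = ι (form p q) v * pseudoscalar p q := by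
  have := gradePart_mem (k := k)
    (S := LinearMap.range (LinearMap.mulRight ℂ (pseudoscalar p q) ∘ₗ ι (form p q)))
    (fun A hA => by
      have hc : Aᶜ.card = 1 := by
        rw [Finset.card_compl, hA, Fintype.card_fin]; omega
      obtain ⟨a, ha⟩ := Finset.card_eq_one.1 hc
      obtain ⟨s, -, e⟩ := blade_compl_singleton (p := p) (q := q) a
      rw [← ha, compl_compl] at e
      refine ⟨s • Pi.single a 1, ?_⟩
      rw [e]
      simp [gen]) U
  obtain ⟨v, hv⟩ := this
  exact ⟨v, hv.symm⟩

/-! ### Rank scalings on these normal forms. -/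

theorem gradeScale_algebraMap (f : ℕ → ℂ) (c : ℂ) :
    gradeScale p q f (algebraMap ℂ _ c) = f 0 • algebraMap ℂ _ c := by
  have : (1 : Cl p q) = blade p q ∅ := by simp [blade]
  rw [Algebra.algebraMap_eq_smul_one, this, map_smul, gradeScale_blade, smul_comm,
    Finset.card_empty]

theorem gradeScale_ι (f : ℕ → ℂ) (v : Fin (p + q) → ℂ) :
    gradeScale p q f (ι _ v) = f 1 • ι _ v := by
  rw [ι_eq_sum, map_sum, Finset.smul_sum]
  refine Finset.sum_congr rfl fun a _ => ?_
  rw [map_smul, ← blade_singleton, gradeScale_blade, smul_comm, Finset.card_singleton]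

theorem gradeScale_pseudoscalar (f : ℕ → ℂ) :
    gradeScale p q f (pseudoscalar p q) = f (p + q) • pseudoscalar p q := by
  rw [gradeScale_blade, Finset.card_univ, Fintype.card_fin]

theorem gradeScale_ι_mul_pseudoscalar (f : ℕ → ℂ) (v : Fin (p + q) → ℂ) :
    gradeScale p q f (ι _ v * pseudoscalar p q) = f (p + q - 1) • (ι _ v * pseudoscalar p q) := by
  rw [ι_eq_sum, Finset.sum_mul, map_sum, Finset.smul_sum]
  refine Finset.sum_congr rfl fun a _ => ?_
  obtain ⟨s, hs, e⟩ := blade_compl_singleton (p := p) (q := q) a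
  have e' : gen p q a * pseudoscalar p q = s⁻¹ • blade p q {a}ᶜ := by
    rw [e, smul_smul, inv_mul_cancel₀ hs, one_smul]
  rw [smul_mul_assoc, e', map_smul, map_smul, gradeScale_blade, Finset.card_compl,
    Fintype.card_fin, Finset.card_singleton, smul_comm (f _), smul_comm (f _)]

/-! ### The conjugations: scalings and (anti)automorphisms. -/

theorem rev_eq_gradeScale (U : Cl p q) :
    rev U = gradeScale p q (fun k => (-1 : ℂ) ^ (k * (k - 1) / 2)) U := rfl

theorem invol_eq_gradeScale (U : Cl p q) : invol U = gradeScale p q (fun k => (-1 : ℂ) ^ k) U :=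
  rfl

theorem nabla_eq_gradeScale (U : Cl p q) :
    nabla U = gradeScale p q (fun k => if k = 4 ∨ k = 5 then -1 else 1) U := rfl

theorem delta_eq_gradeScale (U : Cl p q) :
    delta U = gradeScale p q (fun k => if k = 5 then -1 else 1) U := rfl

theorem cliffConj_eq_gradeScale (U : Cl p q) : cliffConj U =
    gradeScale p q (fun k => (-1 : ℂ) ^ k * (-1 : ℂ) ^ (k * (k - 1) / 2)) U := by
  rw [cliffConj, rev_eq_gradeScale, invol_eq_gradeScale, gradeScale_gradeScale]

theorem invol_mul (U V : Cl p q) : invol (U * V) = invol U * invol V := by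
  simp [invol_eq_involute]

theorem rev_mul (U V : Cl p q) : rev (U * V) = rev V * rev U := by
  simp [rev_eq_reverse]

theorem rev_rev (U : Cl p q) : rev (rev U) = U := by
  simp [rev_eq_reverse]

theorem invol_invol (U : Cl p q) : invol (invol U) = U := by
  simp [invol_eq_involute]

theorem rev_invol (U : Cl p q) : rev (invol U) = invol (rev U) := by
  simp [rev_eq_reverse, invol_eq_involute, reverse_involute]

theorem invol_cliffConj (U : Cl p q) : invol (cliffConj U) = rev U := invol_invol _

theorem rev_mul_rev_self (U : Cl p q) : rev (U * rev U) = U * rev U := by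
  rw [rev_mul, rev_rev]

theorem cliffConj_mul_cliffConj_self (U : Cl p q) :
    cliffConj (U * cliffConj U) = U * cliffConj U := by
  simp only [cliffConj, rev_mul, invol_mul, rev_invol, rev_rev, invol_invol]

/-! ### Units, nonvanishing and the quotient criterion. -/

theorem isUnit_invol {U : Cl p q} (h : IsUnit U) : IsUnit (invol U) := by
  rw [invol_eq_involute]
  exact h.map involute

theorem isUnit_rev {U : Cl p q} (h : IsUnit U) : IsUnit (rev U) := by
  obtain ⟨V, hUV, hVU⟩ := isUnit_iff_exists.1 h
  have h1 : rev (1 : Cl p q) = 1 := by simp [rev_eq_reverse]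
  exact isUnit_iff_exists.2 ⟨rev V, by rw [← rev_mul, hVU, h1], by rw [← rev_mul, hUV, h1]⟩

theorem isUnit_cliffConj {U : Cl p q} (h : IsUnit U) : IsUnit (cliffConj U) :=
  isUnit_invol (isUnit_rev h)

theorem nabla_ne_zero {U : Cl p q} (h : U ≠ 0) : nabla U ≠ 0 := by
  refine gradeScale_ne_zero (fun k => ?_) h
  split_ifs <;> norm_num

theorem delta_ne_zero {U : Cl p q} (h : U ≠ 0) : delta U ≠ 0 := by
  refine gradeScale_ne_zero (fun k => ?_) h
  split_ifs <;> norm_num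

theorem isUnit_mul_ne_zero {U V : Cl p q} (hU : IsUnit U) (hV : V ≠ 0) : U * V ≠ 0 :=
  fun h => hV ((hU.mul_right_eq_zero).1 h)

theorem isQuotient_of_mul {U N : Cl p q} (hU : IsUnit U) (hN : N ≠ 0)
    (h : ∃ d : ℂ, U * N = algebraMap ℂ (Cl p q) d) : IsQuotient (Ring.inverse U) N (U * N) := by
  obtain ⟨d, hd⟩ := h
  have hd0 : d ≠ 0 := by
    rintro rfl
    exact isUnit_mul_ne_zero hU hN (by rw [hd, map_zero])
  refine ⟨d, hd0, hd, ?_⟩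
  apply hU.mul_left_cancel
  rw [Ring.mul_inverse_cancel U hU, mul_smul_comm, hd, Algebra.algebraMap_eq_smul_one, smul_smul,
    inv_mul_cancel₀ hd0, one_smul]

/-! ### Squares that are scalars, or scalars plus pseudoscalars. -/

theorem eq_sum_gradePart {m : ℕ} (h : p + q = m) (U : Cl p q) :
    U = ∑ k ∈ Finset.range (m + 1), gradePart k U := by
  rw [← h, sum_gradePart]

theorem ι_mul_self_mem_bot (v : Fin (p + q) → ℂ) :
    ι (form p q) v * ι (form p q) v ∈ (⊥ : Subalgebra ℂ (Cl p q)) := by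
  rw [ι_sq_scalar]
  exact Subalgebra.algebraMap_mem _ _

theorem pseudoscalar_mul_self_mem_bot (p q : ℕ) :
    pseudoscalar p q * pseudoscalar p q ∈ (⊥ : Subalgebra ℂ (Cl p q)) := by
  obtain ⟨c, hc⟩ := pseudoscalar_mul_self p q
  rw [hc]
  exact Subalgebra.algebraMap_mem _ _

theorem smul_pseudoscalar_mul_self_mem_bot (c : ℂ) :
    (c • pseudoscalar p q) * (c • pseudoscalar p q) ∈ (⊥ : Subalgebra ℂ (Cl p q)) := by
  rw [smul_mul_smul_comm]
  exact Subalgebra.smul_mem _ (pseudoscalar_mul_self_mem_bot p q) _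

theorem add_mul_self_of_anticomm {R : Type*} [Ring R] {x y : R} (h : y * x = -(x * y)) :
    (x + y) * (x + y) = x * x + y * y := by
  rw [add_mul, mul_add, mul_add, h]
  abel

/-- In even positive dimension vectors anticommute with the pseudoscalar, so the cross terms cancel.
-/
theorem ι_add_pseudoscalar_mul_self_mem_bot (h : Even (p + q)) (h0 : p + q ≠ 0)
    (v : Fin (p + q) → ℂ) (c : ℂ) :
    (ι (form p q) v + c • pseudoscalar p q) * (ι (form p q) v + c • pseudoscalar p q) ∈
      (⊥ : Subalgebra ℂ (Cl p q)) := by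
  rw [add_mul_self_of_anticomm
    (by rw [smul_mul_assoc, pseudoscalar_mul_ι_of_even h h0, mul_smul_comm, smul_neg])]
  exact add_mem (ι_mul_self_mem_bot v) (smul_pseudoscalar_mul_self_mem_bot c)

/-- The product `vI` also anticommutes with `I`, and `(vI)² = -v²I²` is a scalar. -/
theorem ι_mul_pseudoscalar_add_mul_self_mem_bot (h : Even (p + q)) (h0 : p + q ≠ 0)
    (v : Fin (p + q) → ℂ) (c : ℂ) :
    (ι (form p q) v * pseudoscalar p q + c • pseudoscalar p q) *
      (ι (form p q) v * pseudoscalar p q + c • pseudoscalar p q) ∈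
      (⊥ : Subalgebra ℂ (Cl p q)) := by
  have hI := pseudoscalar_mul_ι_of_even h h0 v
  rw [add_mul_self_of_anticomm
    (by rw [smul_mul_assoc, ← mul_assoc, hI, mul_smul_comm, neg_mul, smul_neg, mul_assoc])]
  refine add_mem ?_ (smul_pseudoscalar_mul_self_mem_bot c)
  rw [mul_assoc, ← mul_assoc _ _ (pseudoscalar p q), hI, neg_mul, mul_neg, mul_assoc, ← mul_assoc]
  exact neg_mem (mul_mem (ι_mul_self_mem_bot v) (pseudoscalar_mul_self_mem_bot p q))

/-- With `I` central, the cross terms combine to `(vu + uv)I`, and the anticommutator `vu + uv` is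
the polar form. -/
theorem ι_add_ι_mul_pseudoscalar_mul_self (h : Odd (p + q)) (u v : Fin (p + q) → ℂ) :
    ∃ a b : ℂ, (ι (form p q) v + ι (form p q) u * pseudoscalar p q) *
      (ι (form p q) v + ι (form p q) u * pseudoscalar p q) =
      algebraMap ℂ _ a + b • pseudoscalar p q := by
  have hu := pseudoscalar_mul_ι_of_odd h u
  have hv := pseudoscalar_mul_ι_of_odd h v
  obtain ⟨c, hc⟩ := pseudoscalar_mul_self p q
  refine ⟨form p q v + form p q u * c, QuadraticMap.polar (form p q) v u, ?_⟩
  have h1 : ι (form p q) v * (ι (form p q) u * pseudoscalar p q) +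
      ι (form p q) u * pseudoscalar p q * ι (form p q) v =
      QuadraticMap.polar (form p q) v u • pseudoscalar p q := by
    rw [mul_assoc, hv, ← mul_assoc, ← mul_assoc, ← add_mul, ι_mul_ι_add_swap, ← Algebra.smul_def]
  have h2 : ι (form p q) u * pseudoscalar p q * (ι (form p q) u * pseudoscalar p q) =
      algebraMap ℂ _ (form p q u * c) := by
    rw [mul_assoc, ← mul_assoc _ _ (pseudoscalar p q), hu, mul_assoc, ← mul_assoc, hc,
      ι_sq_scalar, map_mul]
  rw [add_mul, mul_add, mul_add, h2, ι_sq_scalar, ← h1, map_add]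
  abel

theorem algebraMap_add_mul_sub_mem_bot {a : ℂ} {X : Cl p q}
    (hX : X * X ∈ (⊥ : Subalgebra ℂ (Cl p q))) :
    ∃ d : ℂ, (algebraMap ℂ (Cl p q) a + X) * (algebraMap ℂ (Cl p q) a - X) =
      algebraMap ℂ (Cl p q) d := by
  rw [← Commute.mul_self_sub_mul_self_eq (Algebra.commutes a X)]
  obtain ⟨d, hd⟩ := Algebra.mem_bot.1 hX
  exact ⟨a * a - d, by rw [← hd, map_sub, map_mul]⟩

/-! ### Scalar products in dimensions 0 to 4. -/

theorem exists_mul_invol_of_vector {V : Cl p q} {a : ℂ} {v : Fin (p + q) → ℂ}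
    (h : V = algebraMap ℂ _ a + ι _ v) :
    ∃ d : ℂ, V * invol V = algebraMap ℂ (Cl p q) d := by
  have : invol V = algebraMap ℂ (Cl p q) a - ι _ v := by
    rw [h, invol_eq_gradeScale, map_add, gradeScale_algebraMap, gradeScale_ι]
    simp [sub_eq_add_neg]
  rw [this, h]
  exact algebraMap_add_mul_sub_mem_bot (ι_mul_self_mem_bot v)

theorem exists_eq_of_dim_zero (hn : p + q = 0) (U : Cl p q) :
    ∃ d : ℂ, U = algebraMap ℂ (Cl p q) d := by
  obtain ⟨a, ha⟩ := gradePart_zero_eq U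
  exact ⟨a, by rw [eq_sum_gradePart hn U]; simp [ha]⟩

theorem exists_mul_invol_of_dim_one (hn : p + q = 1) (U : Cl p q) :
    ∃ d : ℂ, U * invol U = algebraMap ℂ (Cl p q) d := by
  obtain ⟨a, ha⟩ := gradePart_zero_eq U
  obtain ⟨v, hv⟩ := gradePart_one_eq U
  refine exists_mul_invol_of_vector (a := a) (v := v) ?_
  rw [← ha, ← hv]
  simpa [Finset.sum_range_succ] using eq_sum_gradePart hn U

/-- Conjugation negates ranks 1 and 2, so only rank 0 survives in its fixed points. -/
theorem exists_mul_cliffConj_of_dim_two (hn : p + q = 2) (U : Cl p q) :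
    ∃ d : ℂ, U * cliffConj U = algebraMap ℂ (Cl p q) d := by
  have hV := cliffConj_mul_cliffConj_self U
  set V := U * cliffConj U
  rw [cliffConj_eq_gradeScale] at hV
  obtain ⟨a, ha⟩ := gradePart_zero_eq V
  have h1 := gradePart_eq_zero hV (k := 1) (by norm_num)
  have h2 := gradePart_eq_zero hV (k := 2) (by norm_num)
  refine ⟨a, ?_⟩
  rw [eq_sum_gradePart hn V]
  simp [Finset.sum_range_succ, h1, h2, ha]

theorem exists_mul_rev_mul_of_dim_three (hn : p + q = 3) (U : Cl p q) :
    ∃ d : ℂ, U * rev U * invol U * cliffConj U = algebraMap ℂ (Cl p q) d := by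
  rw [mul_assoc, show invol U * cliffConj U = invol (U * rev U) from (invol_mul _ _).symm]
  have hV := rev_mul_rev_self U
  set V := U * rev U
  rw [rev_eq_gradeScale] at hV
  obtain ⟨a, ha⟩ := gradePart_zero_eq V
  obtain ⟨v, hv⟩ := gradePart_one_eq V
  have h2 := gradePart_eq_zero hV (k := 2) (by norm_num)
  have h3 := gradePart_eq_zero hV (k := 3) (by norm_num)
  refine exists_mul_invol_of_vector (a := a) (v := v) ?_
  rw [← ha, ← hv]
  simpa [Finset.sum_range_succ, h2, h3] using eq_sum_gradePart hn V

theorem invol_mul_rev (U : Cl p q) : invol U * rev U = invol (U * cliffConj U) := by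
  rw [invol_mul, invol_cliffConj]

theorem exists_mul_cliffConj_mul_of_dim_three (hn : p + q = 3) (U : Cl p q) :
    ∃ d : ℂ, U * cliffConj U * invol U * rev U = algebraMap ℂ (Cl p q) d := by
  rw [mul_assoc, invol_mul_rev]
  have hV := cliffConj_mul_cliffConj_self U
  set V := U * cliffConj U
  rw [cliffConj_eq_gradeScale] at hV
  obtain ⟨a, ha⟩ := gradePart_zero_eq V
  obtain ⟨b, hb⟩ := gradePart_top_eq hn V
  have h1 := gradePart_eq_zero hV (k := 1) (by norm_num)
  have h2 := gradePart_eq_zero hV (k := 2) (by norm_num)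
  have hVe : V = algebraMap ℂ _ a + b • pseudoscalar p q := by
    rw [← ha, ← hb]
    simpa [Finset.sum_range_succ, h1, h2] using eq_sum_gradePart hn V
  -- The pseudoscalar has odd rank 3, so `invol` negates it.
  have hi : invol V = algebraMap ℂ _ a - b • pseudoscalar p q := by
    rw [hVe, invol_eq_gradeScale]
    simp only [map_add, map_smul, gradeScale_algebraMap, gradeScale_pseudoscalar, hn]
    norm_num [sub_eq_add_neg]
  rw [hi, hVe]
  exact algebraMap_add_mul_sub_mem_bot (smul_pseudoscalar_mul_self_mem_bot b)

theorem exists_mul_rev_mul_of_dim_four (hn : p + q = 4) (U : Cl p q) :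
    ∃ d : ℂ, U * rev U * nabla (invol U * cliffConj U) = algebraMap ℂ (Cl p q) d := by
  rw [show invol U * cliffConj U = invol (U * rev U) from (invol_mul _ _).symm]
  have hV := rev_mul_rev_self U
  set V := U * rev U
  rw [rev_eq_gradeScale] at hV
  obtain ⟨a, ha⟩ := gradePart_zero_eq V
  obtain ⟨v, hv⟩ := gradePart_one_eq V
  obtain ⟨b, hb⟩ := gradePart_top_eq hn V
  have h2 := gradePart_eq_zero hV (k := 2) (by norm_num)
  have h3 := gradePart_eq_zero hV (k := 3) (by norm_num)
  have hVe : V = algebraMap ℂ _ a + (ι _ v + b • pseudoscalar p q) := by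
    rw [← ha, ← hb, ← hv, ← add_assoc]
    simpa [Finset.sum_range_succ, h2, h3] using eq_sum_gradePart hn V
  -- Rank 1 is negated by `invol` and rank 4 by `nabla`.
  have hi : nabla (invol V) = algebraMap ℂ _ a - (ι _ v + b • pseudoscalar p q) := by
    rw [hVe, invol_eq_gradeScale, nabla_eq_gradeScale, gradeScale_gradeScale]
    simp only [map_add, map_smul, gradeScale_algebraMap, gradeScale_pseudoscalar, gradeScale_ι, hn]
    norm_num [sub_eq_add_neg, add_comm]
  rw [hi, hVe]
  exact algebraMap_add_mul_sub_mem_bot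
    (ι_add_pseudoscalar_mul_self_mem_bot (by rw [hn]; decide) (by omega) _ _)

theorem exists_mul_cliffConj_mul_of_dim_four (hn : p + q = 4) (U : Cl p q) :
    ∃ d : ℂ, U * cliffConj U * nabla (invol U * rev U) = algebraMap ℂ (Cl p q) d := by
  rw [invol_mul_rev]
  have hV := cliffConj_mul_cliffConj_self U
  set V := U * cliffConj U
  rw [cliffConj_eq_gradeScale] at hV
  obtain ⟨a, ha⟩ := gradePart_zero_eq V
  obtain ⟨u, hu⟩ := gradePart_pred_eq hn V
  obtain ⟨b, hb⟩ := gradePart_top_eq hn V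
  have h1 := gradePart_eq_zero hV (k := 1) (by norm_num)
  have h2 := gradePart_eq_zero hV (k := 2) (by norm_num)
  have hVe : V = algebraMap ℂ _ a + (ι _ u * pseudoscalar p q + b • pseudoscalar p q) := by
    rw [← ha, ← hb, ← hu, ← add_assoc]
    simpa [Finset.sum_range_succ, h1, h2] using eq_sum_gradePart hn V
  -- Rank 3 is negated by `invol` and rank 4 by `nabla`.
  have hi : nabla (invol V) =
      algebraMap ℂ _ a - (ι _ u * pseudoscalar p q + b • pseudoscalar p q) := by
    rw [hVe, invol_eq_gradeScale, nabla_eq_gradeScale, gradeScale_gradeScale]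
    simp only [map_add, map_smul, gradeScale_algebraMap, gradeScale_pseudoscalar,
      gradeScale_ι_mul_pseudoscalar, hn]
    norm_num [sub_eq_add_neg, add_comm]
  rw [hi, hVe]
  exact algebraMap_add_mul_sub_mem_bot
    (ι_mul_pseudoscalar_add_mul_self_mem_bot (by rw [hn]; decide) (by omega) _ _)

/-! ### Dimension 5. -/

theorem exists_mul_rev_eq_of_dim_five (hn : p + q = 5) (U : Cl p q) :
    ∃ (a b : ℂ) (u v : Fin (p + q) → ℂ), U * rev U =
      (algebraMap ℂ _ a + b • pseudoscalar p q) + (ι _ v + ι _ u * pseudoscalar p q) := by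
  have hV := rev_mul_rev_self U
  set V := U * rev U
  rw [rev_eq_gradeScale] at hV
  obtain ⟨a, ha⟩ := gradePart_zero_eq V
  obtain ⟨v, hv⟩ := gradePart_one_eq V
  obtain ⟨u, hu⟩ := gradePart_pred_eq hn V
  obtain ⟨b, hb⟩ := gradePart_top_eq hn V
  have h2 := gradePart_eq_zero hV (k := 2) (by norm_num)
  have h3 := gradePart_eq_zero hV (k := 3) (by norm_num)
  refine ⟨a, b, u, v, ?_⟩
  have := eq_sum_gradePart hn V
  simp only [Finset.sum_range_succ, Finset.sum_range_zero, h2, h3, ha, hv, hu, hb, zero_add,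
    add_zero] at this
  rw [this]
  abel

/-- Combined signs: ranks 1 and 4 are negated once, rank 5 twice, hence kept. -/
theorem nabla_invol_of_dim_five (hn : p + q = 5) (a b : ℂ) (u v : Fin (p + q) → ℂ) :
    nabla (invol ((algebraMap ℂ (Cl p q) a + b • pseudoscalar p q) +
        (ι _ v + ι _ u * pseudoscalar p q))) =
      (algebraMap ℂ (Cl p q) a + b • pseudoscalar p q) - (ι _ v + ι _ u * pseudoscalar p q) := by
  rw [invol_eq_gradeScale, nabla_eq_gradeScale, gradeScale_gradeScale]
  simp only [map_add, map_smul, gradeScale_algebraMap, gradeScale_pseudoscalar, gradeScale_ι,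
    gradeScale_ι_mul_pseudoscalar, hn]
  norm_num [sub_eq_add_neg, add_comm]

theorem delta_of_dim_five (hn : p + q = 5) (a b : ℂ) :
    delta (algebraMap ℂ (Cl p q) a + b • pseudoscalar p q) =
      algebraMap ℂ (Cl p q) a - b • pseudoscalar p q := by
  rw [delta_eq_gradeScale]
  simp only [map_add, map_smul, gradeScale_algebraMap, gradeScale_pseudoscalar, hn]
  norm_num [sub_eq_add_neg]

theorem algebraMap_add_smul_pseudoscalar_mul (a b c d : ℂ) :
    ∃ e f : ℂ, (algebraMap ℂ (Cl p q) a + b • pseudoscalar p q) *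
      (algebraMap ℂ (Cl p q) c + d • pseudoscalar p q) =
      algebraMap ℂ (Cl p q) e + f • pseudoscalar p q := by
  obtain ⟨s, hs⟩ := pseudoscalar_mul_self p q
  refine ⟨a * c + b * d * s, a * d + b * c, ?_⟩
  simp only [Algebra.algebraMap_eq_smul_one, add_mul, mul_add, smul_mul_assoc, mul_smul_comm,
    one_mul, mul_one] at hs ⊢
  rw [hs]
  module

theorem commute_pseudoscalar_of_odd (h : Odd (p + q)) (a b : ℂ) (u v : Fin (p + q) → ℂ) :
    Commute (algebraMap ℂ (Cl p q) a + b • pseudoscalar p q)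
      (ι _ v + ι _ u * pseudoscalar p q) := by
  refine Commute.add_left (Algebra.commutes _ _) (Commute.smul_left (Commute.add_right
    (pseudoscalar_mul_ι_of_odd h v) (Commute.mul_right (pseudoscalar_mul_ι_of_odd h u)
      (Commute.refl _))) _)

/-- Vectors and their multiples by `I` form a right module over `ℂ + ℂI`, because `I²` is a scalar.
-/
theorem ι_add_ι_mul_pseudoscalar_mul (a b : ℂ) (u v : Fin (p + q) → ℂ) :
    ∃ u' v', (ι (form p q) v + ι _ u * pseudoscalar p q) *
      (algebraMap ℂ (Cl p q) a + b • pseudoscalar p q) =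
      ι (form p q) v' + ι _ u' * pseudoscalar p q := by
  obtain ⟨s, hs⟩ := pseudoscalar_mul_self p q
  refine ⟨a • u + b • v, a • v + (b * s) • u, ?_⟩
  simp only [Algebra.algebraMap_eq_smul_one, map_add, map_smul, add_mul, mul_add,
    smul_mul_assoc, mul_smul_comm, mul_one, mul_assoc] at hs ⊢
  rw [hs, mul_smul_comm, mul_one]
  module

/-- Write `V = z + w` with `z` in ranks 0, 5 and `w` in ranks 1, 4, and let `y` be the second
factor. If `(z - w)y = 0`, then `zy = wy` has ranks in both sets, so both products vanish and `Vy =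
0`, contradicting invertibility of `V`. -/
theorem nabla_invol_mul_delta_ne_zero_of_dim_five (hn : p + q = 5) {V : Cl p q} (hV : IsUnit V)
    {a b : ℂ} {u v : Fin (p + q) → ℂ}
    (hVe : V = (algebraMap ℂ _ a + b • pseudoscalar p q) + (ι _ v + ι _ u * pseudoscalar p q))
    {c d : ℂ} (hcd : algebraMap ℂ (Cl p q) c + d • pseudoscalar p q ≠ 0) :
    nabla (invol V) * (algebraMap ℂ (Cl p q) c + d • pseudoscalar p q) ≠ 0 := by
  intro h
  rw [hVe, nabla_invol_of_dim_five hn, sub_mul, sub_eq_zero] at h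
  obtain ⟨e, f, h1⟩ := algebraMap_add_smul_pseudoscalar_mul (p := p) (q := q) a b c d
  obtain ⟨u', v', h2⟩ := ι_add_ι_mul_pseudoscalar_mul c d u v
  rw [h1, h2] at h
  -- The map `nabla ∘ invol` is `+1` on ranks 0, 5 and `-1` on ranks 1, 4, so the common value of
  -- the two products equals its own negative.
  have h3 := nabla_invol_of_dim_five hn e f 0 0
  have h4 := nabla_invol_of_dim_five hn 0 0 u' v'
  simp only [map_zero, zero_mul, zero_smul, add_zero, sub_zero, zero_add, zero_sub] at h3 h4
  rw [h, h4] at h3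
  have h5 : ι (form p q) v' + ι (form p q) u' * pseudoscalar p q = 0 := by
    refine (smul_eq_zero.1 (?_ : (2 : ℂ) • _ = _)).resolve_left two_ne_zero
    rw [two_smul]
    nth_rewrite 1 [← h3]
    exact neg_add_cancel _
  refine isUnit_mul_ne_zero hV hcd ?_
  rw [hVe, add_mul, h1, h2, h, h5, add_zero]

theorem exists_mul_nabla_eq_of_dim_five (hn : p + q = 5) {V : Cl p q}
    {a b : ℂ} {u v : Fin (p + q) → ℂ}
    (hVe : V = (algebraMap ℂ _ a + b • pseudoscalar p q) + (ι _ v + ι _ u * pseudoscalar p q)) :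
    ∃ c d : ℂ, V * nabla (invol V) = algebraMap ℂ (Cl p q) c + d • pseudoscalar p q := by
  have ho : Odd (p + q) := by rw [hn]; decide
  rw [hVe, nabla_invol_of_dim_five hn,
    ← (commute_pseudoscalar_of_odd ho a b u v).mul_self_sub_mul_self_eq]
  obtain ⟨c, d, h1⟩ := algebraMap_add_smul_pseudoscalar_mul (p := p) (q := q) a b a b
  obtain ⟨e, f, h2⟩ := ι_add_ι_mul_pseudoscalar_mul_self ho u v
  refine ⟨c - e, d - f, ?_⟩
  rw [h1, h2, map_sub]
  module

theorem isQuotient_of_dim_five (hn : p + q = 5) {U : Cl p q} (hU : IsUnit U) :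
    IsQuotient (Ring.inverse U)
      (rev U * nabla (invol U * cliffConj U) *
        delta (U * rev U * nabla (invol U * cliffConj U)))
      (U * rev U * nabla (invol U * cliffConj U) *
        delta (U * rev U * nabla (invol U * cliffConj U))) := by
  rw [show invol U * cliffConj U = invol (U * rev U) from (invol_mul _ _).symm]
  obtain ⟨a, b, u, v, hVe⟩ := exists_mul_rev_eq_of_dim_five hn U
  have hV : IsUnit (U * rev U) := hU.mul (isUnit_rev hU)
  obtain ⟨c, d, hZ⟩ := exists_mul_nabla_eq_of_dim_five hn hVe
  have hZ0 : U * rev U * nabla (invol (U * rev U)) ≠ 0 :=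
    isUnit_mul_ne_zero hV (nabla_ne_zero (isUnit_invol hV).ne_zero)
  have hd := delta_of_dim_five hn c d
  have hd0 := delta_ne_zero hZ0
  -- The `delta` factor is put in the form `c + (-d)I`, again an element of `ℂ + ℂI`.
  rw [hZ, hd, sub_eq_add_neg, ← neg_smul] at hd0
  have hN := nabla_invol_mul_delta_ne_zero_of_dim_five hn hV hVe hd0
  have := isQuotient_of_mul (N := rev U * nabla (invol (U * rev U)) *
      delta (U * rev U * nabla (invol (U * rev U)))) hU ?_ ?_
  · simpa only [mul_assoc] using this
  · rw [hZ, hd, sub_eq_add_neg, ← neg_smul, mul_assoc]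
    exact isUnit_mul_ne_zero (isUnit_rev hU) hN
  · rw [← mul_assoc, ← mul_assoc, hZ, hd]
    exact algebraMap_add_mul_sub_mem_bot (smul_pseudoscalar_mul_self_mem_bot d)

end CliffordInverse

end

/-! ### All dimensions together. -/

open CliffordInverse in
theorem mainTheorem2 (p q : ℕ) (U : Cl p q) (hU : IsUnit U) :
    (p + q = 0 → IsQuotient (Ring.inverse U) 1 U) ∧
    (p + q = 1 → IsQuotient (Ring.inverse U) (invol U) (U * invol U)) ∧
    (p + q = 2 → IsQuotient (Ring.inverse U) (cliffConj U) (U * cliffConj U)) ∧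
    (p + q = 3 →
      IsQuotient (Ring.inverse U)
        (rev U * invol U * cliffConj U)
        (U * rev U * invol U * cliffConj U) ∧
      IsQuotient (Ring.inverse U)
        (cliffConj U * invol U * rev U)
        (U * cliffConj U * invol U * rev U)) ∧
    (p + q = 4 →
      IsQuotient (Ring.inverse U)
        (rev U * nabla (invol U * cliffConj U))
        (U * rev U * nabla (invol U * cliffConj U)) ∧
      IsQuotient (Ring.inverse U)
        (cliffConj U * nabla (invol U * rev U))
        (U * cliffConj U * nabla (invol U * rev U))) ∧
    (p + q = 5 →
      IsQuotient (Ring.inverse U)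
        (rev U * nabla (invol U * cliffConj U) *
          delta (U * rev U * nabla (invol U * cliffConj U)))
        (U * rev U * nabla (invol U * cliffConj U) *
          delta (U * rev U * nabla (invol U * cliffConj U)))) := by
  have hr := isUnit_rev hU
  have hi := isUnit_invol hU
  have hc := isUnit_cliffConj hU
  refine ⟨fun hn => ?_, fun hn => ?_, fun hn => ?_, fun hn => ⟨?_, ?_⟩, fun hn => ⟨?_, ?_⟩,
    fun hn => isQuotient_of_dim_five hn hU⟩
  · have := isQuotient_of_mul hU one_ne_zero
      (by simpa using exists_eq_of_dim_zero hn U)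
    rwa [mul_one] at this
  · exact isQuotient_of_mul hU hi.ne_zero (exists_mul_invol_of_dim_one hn U)
  · exact isQuotient_of_mul hU hc.ne_zero (exists_mul_cliffConj_of_dim_two hn U)
  · have := isQuotient_of_mul hU ((hr.mul hi).mul hc).ne_zero
      (by simpa only [mul_assoc] using exists_mul_rev_mul_of_dim_three hn U)
    simpa only [mul_assoc] using this
  · have := isQuotient_of_mul hU ((hc.mul hi).mul hr).ne_zero
      (by simpa only [mul_assoc] using exists_mul_cliffConj_mul_of_dim_three hn U)
    simpa only [mul_assoc] using this
  · have := isQuotient_of_mul hU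
      (isUnit_mul_ne_zero hr (nabla_ne_zero (hi.mul hc).ne_zero))
      (by simpa only [mul_assoc] using exists_mul_rev_mul_of_dim_four hn U)
    simpa only [mul_assoc] using this
  · have := isQuotient_of_mul hU
      (isUnit_mul_ne_zero hc (nabla_ne_zero (hi.mul hr).ne_zero))
      (by simpa only [mul_assoc] using exists_mul_cliffConj_mul_of_dim_four hn U)
    simpa only [mul_assoc] using this
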